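/- Let $\mathcal D$ be a set of datasets. A mechanism $\mathcal M$ with values in a measurable space $\mathcal O$ assigns to each $D\in\mathcal D$ a probability distribution $\mathcal M(D)$ on $\mathcal O$. A privacy definition $\mathrm{Def}$ (a property of mechanisms) satisfies the *post-processing axiom* if, for every mechanism $\mathcal M$ satisfying $\mathrm{Def}$ and every probabilistic function (Markov kernel) $\kappa$ from $\mathcal O$ to a measurable space $\mathcal O'$, the mechanism $D\mapsto\kappa(\mathcal M(D))$ satisfies $\mathrm{Def}$. It satisfies the *convexity axiom* if, for all mechanisms $\mathcal M_1,\mathcal M_2$ with values in the same space $\mathcal O$ that satisfy $\mathrm{Def}$ and every $p\in[0,1]$, the mechanism that equals $\mathcal M_1(D)$ with probability $p$ and $\mathcal M_2(D)$ with probability $1-p$ satisfies $\mathrm{Def}$. Let $d_{\mathcal D}:\mathcal D^2\to[-\infty,\infty]$ be an arbitrary function. 1. A mechanism $\mathcal M$ satisfies $d_{\mathcal D}$-privacy if $\Pr[\mathcal M(D_1)\in S]\le e^{d_{\mathcal D}(D_1,D_2)}\cdot\Pr[\mathcal M(D_2)\in S]$ for all $D_1,D_2\in\mathcal D$ and all measurable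 $S\subseteq\mathcal O$ (no condition is imposed on pairs with $d_{\mathcal D}(D_1,D_2)=\infty$). Then $d_{\mathcal D}$-privacy satisfies both the post-processing axiom and the convexity axiom. 2. Let $f:(0,\infty)\to\mathbb R$ be any convex function with $f(1)=0$, put $f(0)=\lim_{t\to0^+}f(t)$ and $f'(\infty)=\lim_{t\to\infty}f(t)/t$ (both in $(-\infty,\infty]$), and let $$D_f(\mu\,\|\,\nu)=\int f\Big(\frac{d\mu_a}{d\nu}\Big)\,d\nu+f'(\infty)\,\mu_s(\mathcal O)$$ be the $f$-divergence of probability distributions on $\mathcal O$, where $\mu=\mu_a+\mu_s$ is the Lebesgue decomposition of $\mu$ with respect to $\nu$ and $\infty\cdot0=0$. A mechanism $\mathcal M$ satisfies extended divergence differential privacy (with parameters $f$ and $d_{\mathcal D}$) if $D_f(\mathcal M(D_1)\,\|\,\mathcal M(D_2))\le d_{\mathcal D}(D_1,D_2)$ for all $D_1,D_2\in\mathcal D$. Then extended divergence differential privacy satisfies both the post-processing axiom and the convexity axiom. -/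

import Mathlib

open MeasureTheory ProbabilityTheory Filter Topology Set
open scoped ENNReal

universe u v

noncomputable section

namespace Privacy

/-- A privacy mechanism on the set `𝒟` of datasets with outputs in the measurable space `O`: to each
dataset it assigns a probability distribution on the outputs. -/
abbrev Mechanism (𝒟 O : Type*) [MeasurableSpace O] := 𝒟 → ProbabilityMeasure O

/-- A privacy definition for datasets in `𝒟`: a property of mechanisms, for all output spaces. -/
abbrev PrivacyDef (𝒟 : Type v) :=
  ∀ (O : Type u) [MeasurableSpace O], Mechanism 𝒟 O → Prop

/-- The mechanism `D ↦ κ (M D)`, for a probabilistic function (Markov kernel) `κ`. -/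
def postProcess {𝒟 O O' : Type*} [MeasurableSpace O] [MeasurableSpace O']
    (κ : Kernel O O') [IsMarkovKernel κ] (M : Mechanism 𝒟 O) : Mechanism 𝒟 O' :=
  fun D => ⟨κ ∘ₘ (M D : Measure O), inferInstance⟩

theorem isProbabilityMeasure_mix {O : Type*} [MeasurableSpace O] {p : ℝ} (hp : p ∈ Icc (0 : ℝ) 1)
    (μ ν : Measure O) [IsProbabilityMeasure μ] [IsProbabilityMeasure ν] :
    IsProbabilityMeasure (ENNReal.ofReal p • μ + ENNReal.ofReal (1 - p) • ν) := by
  refine ⟨?_⟩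
  simp [← ENNReal.ofReal_add hp.1 (sub_nonneg.2 hp.2)]

/-- The mechanism that runs `M₁` with probability `p` and `M₂` with probability `1 - p`. -/
def mix {𝒟 O : Type*} [MeasurableSpace O] (p : ℝ) (hp : p ∈ Icc (0 : ℝ) 1)
    (M₁ M₂ : Mechanism 𝒟 O) : Mechanism 𝒟 O :=
  fun D => ⟨ENNReal.ofReal p • (M₁ D : Measure O) + ENNReal.ofReal (1 - p) • (M₂ D : Measure O),
    isProbabilityMeasure_mix hp _ _⟩

/-- The post-processing axiom. -/
def PostProcessingAxiom {𝒟 : Type v} (Def : PrivacyDef.{u, v} 𝒟) : Prop :=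
  ∀ (O O' : Type u) [MeasurableSpace O] [MeasurableSpace O'] (M : Mechanism 𝒟 O)
    (κ : Kernel O O') [IsMarkovKernel κ], Def O M → Def O' (postProcess κ M)

/-- The convexity axiom (privacy axiom of choice). -/
def ConvexityAxiom {𝒟 : Type v} (Def : PrivacyDef.{u, v} 𝒟) : Prop :=
  ∀ (O : Type u) [MeasurableSpace O] (M₁ M₂ : Mechanism 𝒟 O) (p : ℝ) (hp : p ∈ Icc (0 : ℝ) 1),
    Def O M₁ → Def O M₂ → Def O (mix p hp M₁ M₂)

/-- `d`-privacy: `ℙ[M D₁ ∈ S] ≤ e ^ d(D₁, D₂) * ℙ[M D₂ ∈ S]` for all pairs of datasets and all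
measurable sets of outputs. A pair at distance `+∞` is not constrained; this is said explicitly
since `∞ * 0 = 0` in `ℝ≥0∞`. -/
def DPrivacy {𝒟 : Type v} (d : 𝒟 → 𝒟 → EReal) : PrivacyDef.{u, v} 𝒟 :=
  fun O _ M => ∀ D₁ D₂ : 𝒟, d D₁ D₂ ≠ ⊤ → ∀ S : Set O, MeasurableSet S →
    (M D₁ : Measure O) S ≤ EReal.exp (d D₁ D₂) * (M D₂ : Measure O) S

/-- A convex function `f` on `(0, ∞)`, extended to `0` by its limit from the right, which may be
`+∞` (the limit exists by convexity, so it is the upper limit). The value at `∞` plays no role. -/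
def extendZero (f : ℝ → ℝ) (t : ℝ≥0∞) : EReal :=
  if t = 0 then limsup (fun s : ℝ => (f s : EReal)) (𝓝[>] 0) else (f t.toReal : EReal)

/-- `f'(∞) = lim_{s → ∞} f(s) / s` in `(-∞, ∞]` (the limit exists by convexity). -/
def slopeAtTop (f : ℝ → ℝ) : EReal :=
  limsup (fun s : ℝ => ((f s / s : ℝ) : EReal)) atTop

/-- The `f`-divergence `D_f(μ ‖ ν) = ∫ f(dμ/dν) dν + f'(∞) * μₛ(O)`, where `dμ/dν` is the density of
the absolutely continuous part of `μ` and `μₛ` is the part of `μ` that is singular to `ν`.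
The integral is that of the positive part minus that of the negative part; for convex `f` and
finite measures the latter is finite and `f'(∞) ≠ -∞`, so the expression is meaningful. -/
def fDiv {O : Type*} [MeasurableSpace O] (f : ℝ → ℝ) (μ ν : Measure O) : EReal :=
  ((∫⁻ x, (extendZero f (μ.rnDeriv ν x)).toENNReal ∂ν : ℝ≥0∞) : EReal)
    - ((∫⁻ x, (-extendZero f (μ.rnDeriv ν x)).toENNReal ∂ν : ℝ≥0∞) : EReal)
    + slopeAtTop f * ((μ.singularPart ν univ : ℝ≥0∞) : EReal)

/-- Extended divergence differential privacy: `D_f(M D₁ ‖ M D₂) ≤ d(D₁, D₂)` for all pairs of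
datasets. -/
def ExtendedDivergenceDP {𝒟 : Type v} (f : ℝ → ℝ) (d : 𝒟 → 𝒟 → EReal) :
    PrivacyDef.{u, v} 𝒟 :=
  fun O _ M => ∀ D₁ D₂ : 𝒟, fDiv f (M D₁ : Measure O) (M D₂ : Measure O) ≤ d D₁ D₂

end Privacy

end

/-!
Let `w` be the pair of densities of `μ` and `ν` with respect to `ν + μₛ`. The perspective of `f`,
the supremum of the linear forms `(u, v) ↦ a * u + b * v` with `a * t + b ≤ f t` for all `t > 0`,
takes the value `f t` at `(t, 1)` and `f'(∞)` at `(1, 0)`, so `D_f(μ ‖ ν)` is the integral of the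
perspective of `w`. Choosing the best of the first `n` members of a dense sequence of affine
minorants `(a, b)` at each point and letting `n` tend to infinity, one finds

  `D_f(μ ‖ ν) = sup (∫ a dμ + ∫ b dν)`

over all bounded measurable fields `(a, b)` of affine minorants of `f`. The expression in brackets
is linear in `(μ, ν)`, whence joint convexity. Since the affine minorants form a closed convex set,
averaging a field over a Markov kernel gives another field, whence the data processing inequality.
-/

namespace Privacy

section AffineMinorants

variable {f : ℝ → ℝ} {p : ℝ × ℝ} {c s : ℝ} {t : ℝ≥0∞}

/-- The affine functions `t ↦ p.1 * t + p.2` lying below `f` on `(0, ∞)`, encoded by their slope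
and intercept. -/
def affineMinorants (f : ℝ → ℝ) : Set (ℝ × ℝ) :=
  {p | ∀ t, 0 < t → p.1 * t + p.2 ≤ f t}

/-- The homogeneous form of the affine function `t ↦ p.1 * t + p.2`: its value at `(t, 1)` is the
value of that function at `t`, and its value at `(1, 0)` is the slope. -/
def linForm (p w : ℝ × ℝ) : ℝ :=
  p.1 * w.1 + p.2 * w.2

/-- The perspective `(u, v) ↦ v * f (u / v)` of a convex function `f`, defined as a supremum of
linear forms so that it also has the right values where `u = 0` or `v = 0`. -/
noncomputable def perspective (f : ℝ → ℝ) (w : ℝ × ℝ) : EReal :=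
  ⨆ p : affineMinorants f, (linForm p w : EReal)

theorem convex_affineMinorants (f : ℝ → ℝ) : Convex ℝ (affineMinorants f) := by
  simp only [affineMinorants, ofPred_forall]
  refine convex_iInter₂ fun t _ => ?_
  exact convex_halfSpace_le (f := fun p : ℝ × ℝ => p.1 * t + p.2)
    ⟨fun _ _ => by simp only [Prod.fst_add, Prod.snd_add]; ring,
      fun _ _ => by simp only [Prod.smul_fst, Prod.smul_snd, smul_eq_mul]; ring⟩ (f t)

theorem isClosed_affineMinorants (f : ℝ → ℝ) : IsClosed (affineMinorants f) := by
  simp only [affineMinorants, ofPred_forall]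
  exact isClosed_iInter fun t => isClosed_iInter fun _ =>
    isClosed_le (by fun_prop) continuous_const

theorem exists_mem_affineMinorants_eq (hf : ConvexOn ℝ (Ioi 0) f) (hs : 0 < s) :
    ∃ p ∈ affineMinorants f, p.1 * s + p.2 = f s := by
  have hs' : s ∈ interior (Ioi (0 : ℝ)) := by simpa using hs
  refine ⟨(derivWithin f (Ioi s) s, f s - derivWithin f (Ioi s) s * s), fun t ht => ?_, by simp⟩
  dsimp only
  rcases lt_trichotomy s t with hst | rfl | hts
  · have := hf.rightDeriv_le_slope_of_mem_interior hs' ht hst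
    rw [slope_def_field, le_div_iff₀ (sub_pos.2 hst)] at this
    linarith
  · simp
  · have := (hf.slope_le_leftDeriv_of_mem_interior ht hs' hts).trans
      (hf.leftDeriv_le_rightDeriv_of_mem_interior hs')
    rw [slope_def_field, div_le_iff₀ (sub_pos.2 hts)] at this
    linarith

theorem nonempty_affineMinorants (hf : ConvexOn ℝ (Ioi 0) f) : (affineMinorants f).Nonempty :=
  (exists_mem_affineMinorants_eq hf one_pos).imp fun _ hp => hp.1

theorem linForm_le_perspective (hp : p ∈ affineMinorants f) (w : ℝ × ℝ) :
    (linForm p w : EReal) ≤ perspective f w :=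
  le_iSup (fun q : affineMinorants f => (linForm q w : EReal)) ⟨p, hp⟩

theorem linForm_le_extendZero (hp : p ∈ affineMinorants f) (ht : t ≠ ∞) :
    (linForm p (t.toReal, 1) : EReal) ≤ extendZero f t := by
  unfold extendZero
  split_ifs with h
  · have hlim : Tendsto (fun s : ℝ => ((p.1 * s + p.2 : ℝ) : EReal)) (𝓝[>] 0)
        (𝓝 ((p.1 * 0 + p.2 : ℝ) : EReal)) :=
      (continuous_coe_real_ereal.tendsto _).comp
        ((Continuous.tendsto (by fun_prop) 0).mono_left nhdsWithin_le_nhds)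
    rw [linForm, h, ENNReal.toReal_zero, mul_one, ← hlim.limsup_eq]
    refine limsup_le_limsup ?_
    filter_upwards [self_mem_nhdsWithin] with s hs using EReal.coe_le_coe_iff.2 (hp s hs)
  · rw [linForm, mul_one]
    exact EReal.coe_le_coe_iff.2 (hp _ (ENNReal.toReal_pos h ht))

theorem fst_le_slopeAtTop (hp : p ∈ affineMinorants f) : (p.1 : EReal) ≤ slopeAtTop f := by
  have hlim : Tendsto (fun s : ℝ => ((p.1 + p.2 * s⁻¹ : ℝ) : EReal)) atTop
      (𝓝 ((p.1 + p.2 * 0 : ℝ) : EReal)) :=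
    (continuous_coe_real_ereal.tendsto _).comp
      (tendsto_const_nhds.add (tendsto_inv_atTop_zero.const_mul _))
  rw [mul_zero, add_zero] at hlim
  rw [slopeAtTop, ← hlim.limsup_eq]
  refine limsup_le_limsup ?_
  filter_upwards [eventually_gt_atTop 0] with s hs
  rw [EReal.coe_le_coe_iff, le_div_iff₀ hs, add_mul, inv_mul_cancel_right₀ hs.ne']
  exact hp s hs

theorem le_of_forall_intercept_le (hf : ConvexOn ℝ (Ioi 0) f)
    (hc : ∀ p ∈ affineMinorants f, p.2 ≤ c) (hs₀ : 0 < s) (hs₁ : s ≤ 1) :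
    f s ≤ s * f 1 + (1 - s) * c := by
  obtain ⟨p, hp, hps⟩ := exists_mem_affineMinorants_eq hf hs₀
  calc f s = s * (p.1 * 1 + p.2) + (1 - s) * p.2 := by rw [← hps]; ring
    _ ≤ s * f 1 + (1 - s) * c := by
      have := sub_nonneg.2 hs₁
      gcongr
      exacts [hp 1 one_pos, hc p hp]

theorem le_of_forall_slope_le (hf : ConvexOn ℝ (Ioi 0) f)
    (hc : ∀ p ∈ affineMinorants f, p.1 ≤ c) (hs : 1 ≤ s) :
    f s ≤ f 1 + (s - 1) * c := by
  obtain ⟨p, hp, hps⟩ := exists_mem_affineMinorants_eq hf (one_pos.trans_le hs)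
  calc f s = (p.1 * 1 + p.2) + (s - 1) * p.1 := by rw [← hps]; ring
    _ ≤ f 1 + (s - 1) * c := by
      have := sub_nonneg.2 hs
      gcongr
      exacts [hp 1 one_pos, hc p hp]

theorem extendZero_zero_le (hf : ConvexOn ℝ (Ioi 0) f)
    (hc : ∀ p ∈ affineMinorants f, p.2 ≤ c) : extendZero f 0 ≤ c := by
  have hlim : Tendsto (fun s : ℝ => ((s * f 1 + (1 - s) * c : ℝ) : EReal)) (𝓝[>] 0)
      (𝓝 ((0 * f 1 + (1 - 0) * c : ℝ) : EReal)) :=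
    (continuous_coe_real_ereal.tendsto _).comp
      ((Continuous.tendsto (by fun_prop) 0).mono_left nhdsWithin_le_nhds)
  rw [zero_mul, zero_add, sub_zero, one_mul] at hlim
  rw [extendZero, if_pos rfl, ← hlim.limsup_eq]
  refine limsup_le_limsup ?_
  filter_upwards [Ioc_mem_nhdsGT one_pos] with s hs
  exact EReal.coe_le_coe_iff.2 (le_of_forall_intercept_le hf hc hs.1 hs.2)

theorem slopeAtTop_le (hf : ConvexOn ℝ (Ioi 0) f)
    (hc : ∀ p ∈ affineMinorants f, p.1 ≤ c) : slopeAtTop f ≤ c := by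
  have hlim : Tendsto (fun s : ℝ => (((f 1 - c) * s⁻¹ + c : ℝ) : EReal)) atTop
      (𝓝 (((f 1 - c) * 0 + c : ℝ) : EReal)) :=
    (continuous_coe_real_ereal.tendsto _).comp
      ((tendsto_inv_atTop_zero.const_mul _).add_const _)
  rw [mul_zero, zero_add] at hlim
  rw [slopeAtTop, ← hlim.limsup_eq]
  refine limsup_le_limsup ?_
  filter_upwards [eventually_ge_atTop 1] with s hs
  have hs₀ : 0 < s := one_pos.trans_le hs
  rw [EReal.coe_le_coe_iff, div_le_iff₀ hs₀, add_mul, inv_mul_cancel_right₀ hs₀.ne']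
  linarith [le_of_forall_slope_le hf hc hs]

theorem perspective_toReal_one (hf : ConvexOn ℝ (Ioi 0) f) (ht : t ≠ ∞) :
    perspective f (t.toReal, 1) = extendZero f t := by
  refine le_antisymm (iSup_le fun p => linForm_le_extendZero p.2 ht) ?_
  rcases eq_or_ne t 0 with rfl | h
  · refine EReal.le_of_forall_lt_iff_le.1 fun c hc => extendZero_zero_le hf fun p hp => ?_
    simpa [linForm] using EReal.coe_le_coe_iff.1 ((linForm_le_perspective hp _).trans hc.le)
  · obtain ⟨p, hp, hpt⟩ := exists_mem_affineMinorants_eq hf (ENNReal.toReal_pos h ht)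
    rw [extendZero, if_neg h, ← hpt]
    simpa only [linForm, mul_one] using linForm_le_perspective hp (t.toReal, 1)

theorem perspective_one_zero (hf : ConvexOn ℝ (Ioi 0) f) :
    perspective f (1, 0) = slopeAtTop f := by
  refine le_antisymm (iSup_le fun p => by simpa [linForm] using fst_le_slopeAtTop p.2) ?_
  refine EReal.le_of_forall_lt_iff_le.1 fun c hc => slopeAtTop_le hf fun p hp => ?_
  simpa [linForm] using EReal.coe_le_coe_iff.1 ((linForm_le_perspective hp _).trans hc.le)

theorem iSup_linForm_eq_perspective {q : ℕ → affineMinorants f} (hq : DenseRange q)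
    (w : ℝ × ℝ) : ⨆ n, (linForm (q n) w : EReal) = perspective f w := by
  have hcont : Continuous fun p : affineMinorants f => (linForm p w : EReal) :=
    continuous_coe_real_ereal.comp (by unfold linForm; fun_prop)
  rw [perspective, ← Dense.ciSup' hq hcont,
    iSup_range' fun p : affineMinorants f => (linForm p w : EReal)]

end AffineMinorants

theorem exists_measurable_argmax {α β : Type*} [MeasurableSpace α] [LinearOrder β]
    [TopologicalSpace β] [OrderClosedTopology β] [SecondCountableTopology β] [MeasurableSpace β]
    [OpensMeasurableSpace β] {v : ℕ → α → β} (hv : ∀ n, Measurable (v n)) (n : ℕ) :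
    ∃ i : α → ℕ, Measurable i ∧ (∀ x, i x ≤ n) ∧
      ∀ x, v (i x) x = partialSups (fun k => v k x) n := by
  induction n with
  | zero => exact ⟨fun _ => 0, measurable_const, fun _ => le_rfl, fun x => by simp⟩
  | succ n ih =>
    obtain ⟨i, hi, hin, hmax⟩ := ih
    have hvi : Measurable fun x => v (i x) x :=
      (measurable_from_prod_countable_right (f := Function.uncurry v) hv).comp
        (hi.prodMk measurable_id)
    refine ⟨fun x => if v (i x) x < v (n + 1) x then n + 1 else i x,
      Measurable.ite (measurableSet_lt hvi (hv _)) measurable_const hi, fun x => ?_, fun x => ?_⟩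
    · dsimp only
      split_ifs
      exacts [le_rfl, (hin x).trans n.le_succ]
    · rw [partialSups_add_one, ← hmax]
      dsimp only
      split_ifs with h
      exacts [(sup_of_le_right h.le).symm, (sup_of_le_left (not_lt.1 h)).symm]

section ExtendedIntegral

variable {O : Type*} [MeasurableSpace O] {μ ν : Measure O} {h h' : O → EReal} {l : O → ℝ}

/-- The integral of an extended real function, as the integral of its positive part minus that of
its negative part. It is meaningful if one of the two is finite; `∞ - ∞ = -∞`. -/
noncomputable def eintegral (h : O → EReal) (μ : Measure O) : EReal :=
  ((∫⁻ x, (h x).toENNReal ∂μ : ℝ≥0∞) : EReal) - ((∫⁻ x, (-h x).toENNReal ∂μ : ℝ≥0∞) : EReal)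

theorem eintegral_congr_ae (hh : h =ᵐ[μ] h') : eintegral h μ = eintegral h' μ := by
  have hpos : ∫⁻ x, (h x).toENNReal ∂μ = ∫⁻ x, (h' x).toENNReal ∂μ :=
    lintegral_congr_ae (hh.fun_comp EReal.toENNReal)
  have hneg : ∫⁻ x, (-h x).toENNReal ∂μ = ∫⁻ x, (-h' x).toENNReal ∂μ :=
    lintegral_congr_ae (hh.fun_comp fun y => (-y).toENNReal)
  rw [eintegral, hpos, hneg, eintegral]

theorem eintegral_mono_ae (hh : h ≤ᵐ[μ] h') : eintegral h μ ≤ eintegral h' μ := by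
  refine EReal.sub_le_sub (EReal.coe_ennreal_le_coe_ennreal_iff.2 (lintegral_mono_ae ?_))
    (EReal.coe_ennreal_le_coe_ennreal_iff.2 (lintegral_mono_ae ?_))
  · filter_upwards [hh] with x hx using EReal.toENNReal_le_toENNReal hx
  · filter_upwards [hh] with x hx using
      EReal.toENNReal_le_toENNReal (EReal.neg_le_neg_iff.2 hx)

theorem eintegral_const (s : EReal) (μ : Measure O) : eintegral (fun _ => s) μ = s * μ univ := by
  rw [eintegral, lintegral_const, lintegral_const, EReal.coe_ennreal_mul, EReal.coe_ennreal_mul]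
  rcases le_total 0 s with hs | hs
  · have hs' : -s ≤ 0 := by simpa using EReal.neg_le_neg_iff.2 hs
    simp [EReal.coe_toENNReal hs, EReal.toENNReal_of_nonpos hs']
  · have hs' : 0 ≤ -s := by simpa using EReal.neg_le_neg_iff.2 hs
    simp [EReal.coe_toENNReal hs', EReal.toENNReal_of_nonpos hs]

theorem eintegral_add_measure (h : O → EReal) (μ ν : Measure O) :
    eintegral h (μ + ν) = eintegral h μ + eintegral h ν := by
  simp only [eintegral, lintegral_add_measure, EReal.coe_ennreal_add, sub_eq_add_neg]
  rw [EReal.neg_add (Or.inl (EReal.coe_ennreal_ne_bot _)) (Or.inr (EReal.coe_ennreal_ne_bot _)),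
    sub_eq_add_neg, add_add_add_comm]

theorem eintegral_coe (hl : Integrable l μ) :
    eintegral (fun x => (l x : EReal)) μ = (∫ x, l x ∂μ : ℝ) := by
  have hneg : ∫⁻ x, ENNReal.ofReal (-l x) ∂μ ≠ ∞ := hl.neg.lintegral_lt_top.ne
  rw [integral_eq_lintegral_pos_part_sub_lintegral_neg_part hl, EReal.coe_sub,
    EReal.coe_ennreal_toReal hl.lintegral_lt_top.ne, EReal.coe_ennreal_toReal hneg, eintegral]
  simp only [← EReal.coe_neg, EReal.real_coe_toENNReal]

theorem tendsto_eintegral_of_monotone {H : ℕ → O → EReal} (hH : ∀ n, AEMeasurable (H n) μ)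
    (hH₀ : ∫⁻ x, (-H 0 x).toENNReal ∂μ ≠ ∞) (hmono : ∀ᵐ x ∂μ, Monotone fun n => H n x)
    (hlim : ∀ᵐ x ∂μ, Tendsto (fun n => H n x) atTop (𝓝 (h x))) :
    Tendsto (fun n => eintegral (H n) μ) atTop (𝓝 (eintegral h μ)) := by
  have hpos : Tendsto (fun n => ∫⁻ x, (H n x).toENNReal ∂μ) atTop
      (𝓝 (∫⁻ x, (h x).toENNReal ∂μ)) := by
    refine lintegral_tendsto_of_tendsto_of_monotone (fun n => (hH n).ereal_toENNReal) ?_ ?_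
    · filter_upwards [hmono] with x hx m n hmn using EReal.toENNReal_le_toENNReal (hx hmn)
    · filter_upwards [hlim] with x hx using (EReal.continuous_toENNReal.tendsto _).comp hx
  have hneg : Tendsto (fun n => ∫⁻ x, (-H n x).toENNReal ∂μ) atTop
      (𝓝 (∫⁻ x, (-h x).toENNReal ∂μ)) := by
    refine lintegral_tendsto_of_tendsto_of_antitone (fun n => (hH n).neg.ereal_toENNReal) ?_ hH₀ ?_
    · filter_upwards [hmono] with x hx m n hmn using
        EReal.toENNReal_le_toENNReal (EReal.neg_le_neg_iff.2 (hx hmn))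
    · filter_upwards [hlim] with x hx using
        (EReal.continuous_toENNReal.tendsto _).comp ((continuous_neg.tendsto _).comp hx)
  have hfin : ∫⁻ x, (-h x).toENNReal ∂μ ≠ ∞ := by
    refine ne_top_of_le_ne_top hH₀ (lintegral_mono_ae ?_)
    filter_upwards [hmono, hlim] with x hx hx'
    exact EReal.toENNReal_le_toENNReal (EReal.neg_le_neg_iff.2 (hx.ge_of_tendsto hx' 0))
  refine (EReal.continuousAt_add (p := (_, _)) (Or.inr ?_) (Or.inr ?_)).tendsto.comp
    (((continuous_coe_ennreal_ereal.tendsto _).comp hpos).prodMk_nhds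
      ((continuous_neg.tendsto _).comp ((continuous_coe_ennreal_ereal.tendsto _).comp hneg)))
  · simp [hfin]
  · simp

end ExtendedIntegral

section MinorantFields

variable {O : Type*} [MeasurableSpace O] {f : ℝ → ℝ} {p : O → ℝ × ℝ}

/-- A bounded measurable choice of affine minorants of `f`. -/
structure IsMinorantField (f : ℝ → ℝ) (p : O → ℝ × ℝ) : Prop where
  measurable : Measurable p
  bounded : ∃ C, ∀ x, ‖p x‖ ≤ C
  mem : ∀ x, p x ∈ affineMinorants f

theorem IsMinorantField.integrable (hp : IsMinorantField f p) (μ : Measure O)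
    [IsFiniteMeasure μ] : Integrable p μ :=
  hp.bounded.elim fun C hC => .of_bound hp.measurable.aestronglyMeasurable C (ae_of_all _ hC)

theorem exists_seq_isMinorantField (hf : ConvexOn ℝ (Ioi 0) f) {w : O → ℝ × ℝ}
    (hw : Measurable w) :
    ∃ p : ℕ → O → ℝ × ℝ, (∀ n, IsMinorantField f (p n)) ∧
      (∀ x, Monotone fun n => (linForm (p n x) (w x) : EReal)) ∧
      ∀ x, Tendsto (fun n => (linForm (p n x) (w x) : EReal)) atTop (𝓝 (perspective f (w x))) := by
  have : Nonempty (affineMinorants f) := (nonempty_affineMinorants hf).to_subtype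
  let q : ℕ → affineMinorants f := TopologicalSpace.denseSeq _
  have hq : ∀ n, Measurable fun x => (linForm (q n) (w x) : EReal) := fun n => by
    unfold linForm
    fun_prop
  choose i hi hin hmax using exists_measurable_argmax hq
  refine ⟨fun n x => q (i n x), fun n => ⟨?_, ?_, fun x => (q (i n x)).2⟩, fun x => ?_, fun x => ?_⟩
  · exact (measurable_from_nat (f := fun k => (q k : ℝ × ℝ))).comp (hi n)
  · refine ⟨∑ k ∈ Finset.range (n + 1), ‖(q k : ℝ × ℝ)‖, fun x => ?_⟩
    exact Finset.single_le_sum (f := fun k => ‖(q k : ℝ × ℝ)‖) (fun _ _ => norm_nonneg _)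
      (Finset.mem_range_succ_iff.2 (hin n x))
  · simp only [hmax]
    exact (partialSups fun k => (linForm (q k) (w x) : EReal)).monotone
  · simp only [hmax]
    rw [← iSup_linForm_eq_perspective (TopologicalSpace.denseRange_denseSeq _),
      ← iSup_partialSups_eq]
    exact tendsto_atTop_iSup (OrderHom.monotone _)

end MinorantFields

section Duality

variable {O : Type*} [MeasurableSpace O] {f : ℝ → ℝ} {p : O → ℝ × ℝ}

/-- The expression `∫ a dμ + ∫ b dν` for a bounded field of affine functions `p = (a, b)`. The
divergence is its supremum over the minorant fields of `f`, see `fDiv_le_iff`. -/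
noncomputable def dualPairing (p : O → ℝ × ℝ) (μ ν : Measure O) : ℝ :=
  (∫ x, p x ∂μ).1 + (∫ x, p x ∂ν).2

/-- The densities of `μ` and `ν` with respect to `ν + μ.singularPart ν`. -/
noncomputable def densityPair (μ ν : Measure O) (x : O) : ℝ × ℝ :=
  open Classical in
  if x ∈ (Measure.mutuallySingular_singularPart μ ν).nullSet then ((μ.rnDeriv ν x).toReal, 1)
  else (1, 0)

theorem measurable_densityPair (μ ν : Measure O) : Measurable (densityPair μ ν) :=
  Measurable.ite (Measure.mutuallySingular_singularPart μ ν).measurableSet_nullSet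
    ((Measure.measurable_rnDeriv μ ν).ennreal_toReal.prodMk measurable_const) measurable_const

theorem densityPair_ae_eq (μ ν : Measure O) :
    densityPair μ ν =ᵐ[ν] fun x => ((μ.rnDeriv ν x).toReal, 1) := by
  filter_upwards [measure_eq_zero_iff_ae_notMem.1
    (Measure.mutuallySingular_singularPart μ ν).measure_compl_nullSet] with x hx
  exact if_pos (not_not.1 hx)

theorem densityPair_ae_eq_singularPart (μ ν : Measure O) :
    densityPair μ ν =ᵐ[μ.singularPart ν] fun _ => (1, 0) := by
  filter_upwards [measure_eq_zero_iff_ae_notMem.1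
    (Measure.mutuallySingular_singularPart μ ν).measure_nullSet] with x hx
  exact if_neg hx

theorem fDiv_eq_eintegral (hf : ConvexOn ℝ (Ioi 0) f) (μ ν : Measure O) [IsFiniteMeasure μ] :
    fDiv f μ ν
      = eintegral (fun x => perspective f (densityPair μ ν x)) (ν + μ.singularPart ν) := by
  have hν : (fun x => perspective f (densityPair μ ν x))
      =ᵐ[ν] fun x => extendZero f (μ.rnDeriv ν x) := by
    filter_upwards [densityPair_ae_eq μ ν, μ.rnDeriv_ne_top ν] with x hx ht
    rw [hx, perspective_toReal_one hf ht]
  have hs : (fun x => perspective f (densityPair μ ν x))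
      =ᵐ[μ.singularPart ν] fun _ => slopeAtTop f := by
    filter_upwards [densityPair_ae_eq_singularPart μ ν] with x hx
    rw [hx, perspective_one_zero hf]
  rw [eintegral_add_measure, eintegral_congr_ae hν, eintegral_congr_ae hs, eintegral_const]
  rfl

theorem linForm_densityPair_ae_eq (p : O → ℝ × ℝ) (μ ν : Measure O) :
    (fun x => linForm (p x) (densityPair μ ν x))
      =ᵐ[ν] fun x => (μ.rnDeriv ν x).toReal * (p x).1 + (p x).2 := by
  filter_upwards [densityPair_ae_eq μ ν] with x hx
  simp only [hx, linForm, mul_one, mul_comm]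

theorem linForm_densityPair_ae_eq_singularPart (p : O → ℝ × ℝ) (μ ν : Measure O) :
    (fun x => linForm (p x) (densityPair μ ν x)) =ᵐ[μ.singularPart ν] fun x => (p x).1 := by
  filter_upwards [densityPair_ae_eq_singularPart μ ν] with x hx
  simp only [hx, linForm, mul_one, mul_zero, add_zero]

theorem IsMinorantField.integrable_rnDeriv_mul_fst (hp : IsMinorantField f p)
    (μ ν : Measure O) [IsFiniteMeasure μ] :
    Integrable (fun x => (μ.rnDeriv ν x).toReal * (p x).1) ν := by
  obtain ⟨C, hC⟩ := hp.bounded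
  exact Measure.integrable_toReal_rnDeriv.mul_bdd hp.measurable.fst.aestronglyMeasurable
    (ae_of_all _ fun x => (norm_fst_le _).trans (hC x))

variable (μ ν : Measure O) [IsFiniteMeasure μ] [IsFiniteMeasure ν]

theorem IsMinorantField.integrable_linForm (hp : IsMinorantField f p) :
    Integrable (fun x => linForm (p x) (densityPair μ ν x)) (ν + μ.singularPart ν) :=
  integrable_add_measure.2
    ⟨((hp.integrable_rnDeriv_mul_fst μ ν).add (hp.integrable ν).snd).congr
      (linForm_densityPair_ae_eq p μ ν).symm,
    (hp.integrable _).fst.congr (linForm_densityPair_ae_eq_singularPart p μ ν).symm⟩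

theorem IsMinorantField.dualPairing_eq_integral (hp : IsMinorantField f p) :
    dualPairing p μ ν = ∫ x, linForm (p x) (densityPair μ ν x) ∂(ν + μ.singularPart ν) := by
  have hint := integrable_add_measure.1 (hp.integrable_linForm μ ν)
  have hμ : ∫ x, (p x).1 ∂μ
      = ∫ x, (p x).1 ∂(μ.singularPart ν) + ∫ x, (μ.rnDeriv ν x).toReal * (p x).1 ∂ν := by
    conv_lhs => rw [← Measure.singularPart_add_rnDeriv μ ν]
    rw [integral_add_measure (hp.integrable _).fst (hp.integrable _).fst,
      integral_withDensity_eq_integral_toReal_smul (Measure.measurable_rnDeriv μ ν)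
        (Measure.rnDeriv_lt_top μ ν)]
    simp only [smul_eq_mul]
  rw [integral_add_measure hint.1 hint.2, integral_congr_ae (linForm_densityPair_ae_eq p μ ν),
    integral_congr_ae (linForm_densityPair_ae_eq_singularPart p μ ν),
    integral_add (hp.integrable_rnDeriv_mul_fst μ ν) (hp.integrable ν).snd, dualPairing,
    fst_integral (hp.integrable μ), snd_integral (hp.integrable ν), hμ]
  ring

theorem IsMinorantField.dualPairing_le_fDiv (hp : IsMinorantField f p)
    (hf : ConvexOn ℝ (Ioi 0) f) : (dualPairing p μ ν : EReal) ≤ fDiv f μ ν := by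
  rw [hp.dualPairing_eq_integral μ ν, ← eintegral_coe (hp.integrable_linForm μ ν),
    fDiv_eq_eintegral hf]
  exact eintegral_mono_ae (ae_of_all _ fun x => linForm_le_perspective (hp.mem x) _)

theorem fDiv_le_iff (hf : ConvexOn ℝ (Ioi 0) f) {c : EReal} :
    fDiv f μ ν ≤ c ↔ ∀ p, IsMinorantField f p → (dualPairing p μ ν : EReal) ≤ c := by
  refine ⟨fun h p hp => (hp.dualPairing_le_fDiv μ ν hf).trans h, fun h => ?_⟩
  obtain ⟨p, hp, hmono, hlim⟩ := exists_seq_isMinorantField hf (measurable_densityPair μ ν)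
  have hint := fun n => (hp n).integrable_linForm μ ν
  rw [fDiv_eq_eintegral hf]
  refine le_of_tendsto' (tendsto_eintegral_of_monotone
    (fun n => (hint n).aemeasurable.coe_real_ereal) ?_ (ae_of_all _ hmono) (ae_of_all _ hlim))
    fun n => ?_
  · simpa [← EReal.coe_neg] using (hint 0).neg.lintegral_lt_top.ne
  · rw [eintegral_coe (hint n), ← (hp n).dualPairing_eq_integral μ ν]
    exact h _ (hp n)

end Duality

section DivergenceInequalities

variable {O O' : Type*} [MeasurableSpace O] [MeasurableSpace O'] {f : ℝ → ℝ}

theorem integral_kernel_comp {E : Type*} [NormedAddCommGroup E] [NormedSpace ℝ E]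
    (κ : Kernel O O') [IsSFiniteKernel κ] (μ : Measure O) [SFinite μ] {g : O' → E}
    (hg : Integrable g (κ ∘ₘ μ)) : ∫ y, g y ∂(κ ∘ₘ μ) = ∫ x, ∫ y, g y ∂(κ x) ∂μ :=
  Kernel.integral_comp (κ := Kernel.const Unit μ) (η := κ) (a := ()) hg

theorem IsMinorantField.comp_kernel {p : O' → ℝ × ℝ} (hp : IsMinorantField f p)
    (κ : Kernel O O') [IsMarkovKernel κ] : IsMinorantField f fun x => ∫ y, p y ∂(κ x) where
  measurable := hp.measurable.stronglyMeasurable.integral_kernel.measurable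
  bounded := hp.bounded.imp fun C hC x => by
    simpa using norm_integral_le_of_norm_le_const (μ := κ x) (ae_of_all _ hC)
  mem x := (convex_affineMinorants f).integral_mem (isClosed_affineMinorants f)
    (ae_of_all _ hp.mem) (hp.integrable _)

theorem fDiv_comp_le (hf : ConvexOn ℝ (Ioi 0) f) (κ : Kernel O O') [IsMarkovKernel κ]
    (μ ν : Measure O) [IsFiniteMeasure μ] [IsFiniteMeasure ν] :
    fDiv f (κ ∘ₘ μ) (κ ∘ₘ ν) ≤ fDiv f μ ν := by
  refine (fDiv_le_iff _ _ hf).2 fun p hp => ?_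
  have hpair : dualPairing p (κ ∘ₘ μ) (κ ∘ₘ ν)
      = dualPairing (fun x => ∫ y, p y ∂(κ x)) μ ν := by
    rw [dualPairing, integral_kernel_comp κ μ (hp.integrable _),
      integral_kernel_comp κ ν (hp.integrable _), dualPairing]
  rw [hpair]
  exact (hp.comp_kernel κ).dualPairing_le_fDiv μ ν hf

theorem fDiv_add_le (hf : ConvexOn ℝ (Ioi 0) f) (μ₁ μ₂ ν₁ ν₂ : Measure O) [IsFiniteMeasure μ₁]
    [IsFiniteMeasure μ₂] [IsFiniteMeasure ν₁] [IsFiniteMeasure ν₂] :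
    fDiv f (μ₁ + μ₂) (ν₁ + ν₂) ≤ fDiv f μ₁ ν₁ + fDiv f μ₂ ν₂ := by
  refine (fDiv_le_iff _ _ hf).2 fun p hp => ?_
  have hpair : dualPairing p (μ₁ + μ₂) (ν₁ + ν₂)
      = dualPairing p μ₁ ν₁ + dualPairing p μ₂ ν₂ := by
    simp only [dualPairing, integral_add_measure (hp.integrable _) (hp.integrable _),
      Prod.fst_add, Prod.snd_add]
    ring
  rw [hpair, EReal.coe_add]
  exact add_le_add (hp.dualPairing_le_fDiv _ _ hf) (hp.dualPairing_le_fDiv _ _ hf)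

theorem fDiv_smul_le (hf : ConvexOn ℝ (Ioi 0) f) {c : ℝ≥0∞} (hc : c ≠ ∞) (μ ν : Measure O)
    [IsFiniteMeasure μ] [IsFiniteMeasure ν] : fDiv f (c • μ) (c • ν) ≤ c * fDiv f μ ν := by
  have := μ.smul_finite hc
  have := ν.smul_finite hc
  refine (fDiv_le_iff _ _ hf).2 fun p hp => ?_
  have hpair : dualPairing p (c • μ) (c • ν) = c.toReal * dualPairing p μ ν := by
    simp only [dualPairing, integral_smul_measure, Prod.smul_fst, Prod.smul_snd, smul_eq_mul]
    ring
  rw [hpair, EReal.coe_mul, EReal.coe_ennreal_toReal hc]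
  exact mul_le_mul_of_nonneg_left (hp.dualPairing_le_fDiv _ _ hf) (EReal.coe_ennreal_nonneg c)

theorem fDiv_smul_add_smul_le (hf : ConvexOn ℝ (Ioi 0) f) {a b : ℝ≥0∞} (ha : a ≠ ∞)
    (hb : b ≠ ∞) (μ₁ μ₂ ν₁ ν₂ : Measure O) [IsFiniteMeasure μ₁] [IsFiniteMeasure μ₂]
    [IsFiniteMeasure ν₁] [IsFiniteMeasure ν₂] :
    fDiv f (a • μ₁ + b • μ₂) (a • ν₁ + b • ν₂) ≤ a * fDiv f μ₁ ν₁ + b * fDiv f μ₂ ν₂ := by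
  have := μ₁.smul_finite ha
  have := ν₁.smul_finite ha
  have := μ₂.smul_finite hb
  have := ν₂.smul_finite hb
  exact (fDiv_add_le hf _ _ _ _).trans
    (add_le_add (fDiv_smul_le hf ha _ _) (fDiv_smul_le hf hb _ _))

end DivergenceInequalities

section Axioms

variable {𝒟 : Type v} {d : 𝒟 → 𝒟 → EReal} {f : ℝ → ℝ}

theorem comp_le_comp {O O' : Type*} [MeasurableSpace O] [MeasurableSpace O'] {μ ν : Measure O}
    (h : μ ≤ ν) (κ : Kernel O O') : κ ∘ₘ μ ≤ κ ∘ₘ ν := by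
  refine Measure.le_iff.2 fun S hS => ?_
  rw [Measure.bind_apply hS κ.aemeasurable, Measure.bind_apply hS κ.aemeasurable]
  exact lintegral_mono' h le_rfl

theorem dPrivacy_iff_le_smul {O : Type u} [MeasurableSpace O] {M : Mechanism 𝒟 O} :
    DPrivacy d O M ↔
      ∀ D₁ D₂, d D₁ D₂ ≠ ⊤ → (M D₁ : Measure O) ≤ EReal.exp (d D₁ D₂) • (M D₂ : Measure O) := by
  simp only [DPrivacy, Measure.le_iff, Measure.smul_apply, smul_eq_mul]

variable (d)

theorem postProcessingAxiom_dPrivacy : PostProcessingAxiom (DPrivacy.{u, v} d) := by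
  intro O O' _ _ M κ _ hM
  rw [dPrivacy_iff_le_smul] at hM ⊢
  intro D₁ D₂ hd
  calc κ ∘ₘ (M D₁ : Measure O)
      ≤ κ ∘ₘ (EReal.exp (d D₁ D₂) • (M D₂ : Measure O)) := comp_le_comp (hM D₁ D₂ hd) κ
    _ = EReal.exp (d D₁ D₂) • (κ ∘ₘ (M D₂ : Measure O)) := Measure.comp_smul _

theorem convexityAxiom_dPrivacy : ConvexityAxiom (DPrivacy.{u, v} d) := by
  intro O _ M₁ M₂ p hp h₁ h₂
  rw [dPrivacy_iff_le_smul] at h₁ h₂ ⊢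
  intro D₁ D₂ hd
  change ENNReal.ofReal p • (M₁ D₁ : Measure O) + ENNReal.ofReal (1 - p) • (M₂ D₁ : Measure O)
    ≤ EReal.exp (d D₁ D₂) • (ENNReal.ofReal p • (M₁ D₂ : Measure O)
      + ENNReal.ofReal (1 - p) • (M₂ D₂ : Measure O))
  rw [smul_add, smul_comm _ (ENNReal.ofReal p), smul_comm _ (ENNReal.ofReal (1 - p))]
  gcongr
  exacts [h₁ D₁ D₂ hd, h₂ D₁ D₂ hd]

theorem postProcessingAxiom_extendedDivergenceDP (hf : ConvexOn ℝ (Ioi 0) f) :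
    PostProcessingAxiom (ExtendedDivergenceDP.{u, v} f d) :=
  fun _ _ _ _ _ κ _ hM D₁ D₂ => (fDiv_comp_le hf κ _ _).trans (hM D₁ D₂)

theorem convexityAxiom_extendedDivergenceDP (hf : ConvexOn ℝ (Ioi 0) f) :
    ConvexityAxiom (ExtendedDivergenceDP.{u, v} f d) := by
  intro O _ M₁ M₂ p hp h₁ h₂ D₁ D₂
  have hsum : ENNReal.ofReal p + ENNReal.ofReal (1 - p) = 1 := by
    rw [← ENNReal.ofReal_add hp.1 (sub_nonneg.2 hp.2), add_sub_cancel, ENNReal.ofReal_one]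
  have hp₀ := EReal.coe_ennreal_nonneg (ENNReal.ofReal p)
  have hp₁ := EReal.coe_ennreal_nonneg (ENNReal.ofReal (1 - p))
  calc fDiv f (mix p hp M₁ M₂ D₁ : Measure O) (mix p hp M₁ M₂ D₂ : Measure O)
      ≤ ENNReal.ofReal p * fDiv f (M₁ D₁ : Measure O) (M₁ D₂ : Measure O)
        + ENNReal.ofReal (1 - p) * fDiv f (M₂ D₁ : Measure O) (M₂ D₂ : Measure O) :=
        fDiv_smul_add_smul_le hf ENNReal.ofReal_ne_top ENNReal.ofReal_ne_top _ _ _ _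
    _ ≤ ENNReal.ofReal p * d D₁ D₂ + ENNReal.ofReal (1 - p) * d D₁ D₂ :=
        add_le_add (mul_le_mul_of_nonneg_left (h₁ D₁ D₂) hp₀)
          (mul_le_mul_of_nonneg_left (h₂ D₁ D₂) hp₁)
    _ = d D₁ D₂ := by
        rw [← EReal.right_distrib_of_nonneg hp₀ hp₁, ← EReal.coe_ennreal_add, hsum,
          EReal.coe_ennreal_one, one_mul]

end Axioms

end Privacy

theorem mainTheorem3_general {𝒟 : Type v} (d : 𝒟 → 𝒟 → EReal) :
    (Privacy.PostProcessingAxiom (Privacy.DPrivacy.{u, v} d) ∧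
      Privacy.ConvexityAxiom (Privacy.DPrivacy.{u, v} d)) ∧
    ∀ f : ℝ → ℝ, ConvexOn ℝ (Set.Ioi 0) f →
      Privacy.PostProcessingAxiom (Privacy.ExtendedDivergenceDP.{u, v} f d) ∧
      Privacy.ConvexityAxiom (Privacy.ExtendedDivergenceDP.{u, v} f d) :=
  ⟨⟨Privacy.postProcessingAxiom_dPrivacy d, Privacy.convexityAxiom_dPrivacy d⟩,
    fun _ hf => ⟨Privacy.postProcessingAxiom_extendedDivergenceDP d hf,
      Privacy.convexityAxiom_extendedDivergenceDP d hf⟩⟩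

theorem mainTheorem3 {𝒟 : Type v} (d : 𝒟 → 𝒟 → EReal) :
    (Privacy.PostProcessingAxiom (Privacy.DPrivacy.{u, v} d) ∧
      Privacy.ConvexityAxiom (Privacy.DPrivacy.{u, v} d)) ∧
    ∀ f : ℝ → ℝ, ConvexOn ℝ (Set.Ioi 0) f → f 1 = 0 →
      Privacy.PostProcessingAxiom (Privacy.ExtendedDivergenceDP.{u, v} f d) ∧
      Privacy.ConvexityAxiom (Privacy.ExtendedDivergenceDP.{u, v} f d) :=
  ⟨(mainTheorem3_general d).1, fun f hf _ => (mainTheorem3_general d).2 f hf⟩
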